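/- Let $\Omega\subset\mathbb R^2$ be a nonempty open convex polygon, and let $x_1,\dots,x_M\in\overline\Omega$ be distinct nodes that include all vertices of $\Omega$. A node is interior if $x_i\in\Omega$ and a boundary node if $x_i\in\partial\Omega$. The Voronoi polygon of $x_i$ is the set of points strictly closer to $x_i$ than to every other node (the triangulation dual to the Voronoi polygons is the Delaunay triangulation), and the control volume $\Omega_i$ is the part of the Voronoi polygon of $x_i$ that lies in $\Omega$. Assume that the Voronoi polygon of every interior node is contained in $\Omega$, so that only those of boundary nodes are truncated. Let $V_i$ be the area of $\Omega_i$, let $\Gamma_{ij}=\partial\Omega_i\cap\partial\Omega_j$ for $i\ne j$, let $l_{ij}$ be the length of $\Gamma_{ij}$, let $\mathcal W(i)=\{j\neq i:\Gamma_{ij}\neq\emptyset\}$, $d_{ij}=|x_i-x_j|$ and $x_{ij}=\tfrac12(x_i+x_j)$. Let $H$ be the space of functions $y$ on the nodes that vanish at the boundary nodes, with $(y,w)=\sum_{x_i\in\Omega}V_iy_iw_i$ and $\|y\|=(y,y)^{1/2}$. For a function $k$ define the operator $D$ on $H$ by $$(Dy)_i=-\frac1{V_i}\sum_{j\in\mathcal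 W(i)}l_{ij}\,k(x_{ij})\,\frac{y_j-y_i}{d_{ij}},\qquad x_i\in\Omega,$$ and let $\Lambda$ be the operator $D$ with $k\equiv1$. Let $l_1,l_2$ be the side lengths of a rectangle with sides parallel to the coordinate axes that contains $\Omega$, and put $M_0=\frac{l_1^2}{16}+\frac{l_2^2}{16}$. Then every $y\in H$ satisfies the discrete Friedrichs inequality $$\|y\|^2\le M_0\,(\Lambda y,y)$$ and, equivalently, $$\|y\|^2\le\frac{M_0}{2}\sum_{i=1}^{M}\sum_{j\in\mathcal W(i)}l_{ij}\,d_{ij}\left(\frac{y_j-y_i}{d_{ij}}\right)^2 .$$ Moreover, if $k(x)\ge\kappa>0$ for all $x\in\Omega$, then $D=D^*\ge\frac{\kappa}{M_0}E$ in $H$, where $E$ is the identity; that is, $(Dy,w)=(y,Dw)$ and $(Dy,y)\ge\frac{\kappa}{M_0}(y,y)$ for all $y,w\in H$. -/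

import Mathlib

open scoped MeasureTheory

noncomputable section

namespace VoronoiFV

/-- The Euclidean plane. -/
abbrev Plane := EuclideanSpace ℝ (Fin 2)

/-- `Ω` is an open convex polygon: the nonempty interior of the convex hull of finitely many
points. -/
def IsConvexPolygon (Ω : Set Plane) : Prop :=
  ∃ s : Finset Plane, Ω = interior (convexHull ℝ (s : Set Plane)) ∧ Ω.Nonempty

/-- `x 0, …, x (M - 1)` are the (distinct) nodes of a grid in the closed polygon `closure Ω`, and
every vertex of the polygon is a node. -/
structure IsGrid {M : ℕ} (Ω : Set Plane) (x : Fin M → Plane) : Prop where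
  injective : Function.Injective x
  mem_closure : ∀ i, x i ∈ closure Ω
  vertices : Set.extremePoints ℝ (closure Ω) ⊆ Set.range x

/-- The Voronoi polygon of the node `x i`: the points closer to `x i` than to all other nodes. -/
def voronoi {M : ℕ} (x : Fin M → Plane) (i : Fin M) : Set Plane :=
  {p | ∀ j, j ≠ i → dist p (x i) < dist p (x j)}

/-- The control volume `Ω_i`: the part of the Voronoi polygon of `x i` belonging to `Ω`. -/
def controlVolume {M : ℕ} (Ω : Set Plane) (x : Fin M → Plane) (i : Fin M) : Set Plane :=
  voronoi x i ∩ Ω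

/-- The common face `Γ_ij = ∂Ω_i ∩ ∂Ω_j` of two control volumes. -/
def face {M : ℕ} (Ω : Set Plane) (x : Fin M → Plane) (i j : Fin M) : Set Plane :=
  frontier (controlVolume Ω x i) ∩ frontier (controlVolume Ω x j)

/-- The area `V_i` of the control volume `Ω_i`. -/
def area {M : ℕ} (Ω : Set Plane) (x : Fin M → Plane) (i : Fin M) : ℝ :=
  (MeasureTheory.volume (controlVolume Ω x i)).toReal

/-- The length `l_ij` of the face `Γ_ij` (its one-dimensional Hausdorff measure). -/
def faceLength {M : ℕ} (Ω : Set Plane) (x : Fin M → Plane) (i j : Fin M) : ℝ :=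
  (μH[1] (face Ω x i j)).toReal

open Classical in
/-- The (indices of the) interior nodes. -/
def interiorNodes {M : ℕ} (Ω : Set Plane) (x : Fin M → Plane) : Finset (Fin M) :=
  {i | x i ∈ Ω}

open Classical in
/-- The neighbours `W(i)` of the node `i`: the nodes `j ≠ i` whose control volumes have a common
face with the control volume of `i`. -/
def neighbours {M : ℕ} (Ω : Set Plane) (x : Fin M → Plane) (i : Fin M) : Finset (Fin M) :=
  {j | j ≠ i ∧ (face Ω x i j).Nonempty}

/-- The space `H` of grid functions vanishing at the boundary nodes. -/
def gridSpace {M : ℕ} (Ω : Set Plane) (x : Fin M → Plane) : Submodule ℝ (Fin M → ℝ) where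
  carrier := {y | ∀ i, x i ∈ frontier Ω → y i = 0}
  add_mem' := by
    intro y w hy hw i hi
    simp [hy i hi, hw i hi]
  zero_mem' := by
    intro i _
    rfl
  smul_mem' := by
    intro c y hy i hi
    simp [hy i hi]

/-- The scalar product `(y, w) = ∑ V_i y_i w_i` over the interior nodes. -/
def ip {M : ℕ} (Ω : Set Plane) (x : Fin M → Plane) (y w : Fin M → ℝ) : ℝ :=
  ∑ i ∈ interiorNodes Ω x, area Ω x i * y i * w i

/-- The norm `‖y‖ = (y, y)^{1/2}`. -/
def gridNorm {M : ℕ} (Ω : Set Plane) (x : Fin M → Plane) (y : Fin M → ℝ) : ℝ :=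
  Real.sqrt (ip Ω x y y)

open Classical in
/-- The finite-volume operator of diffusive transport with the coefficient `k`, as a linear
operator on the space `H`: at an interior node,
`(D y)_i = -(1 / V_i) ∑_{j ∈ W(i)} l_ij k(x_ij) (y_j - y_i) / d(x_i, x_j)`,
where `x_ij` is the midpoint of `x_i` and `x_j`. (All nodes lie in `closure Ω` with `Ω` open, so a
node is interior if and only if it is not in `frontier Ω`.) -/
def diffusion {M : ℕ} (Ω : Set Plane) (x : Fin M → Plane) (k : Plane → ℝ) :
    gridSpace Ω x →ₗ[ℝ] gridSpace Ω x where
  toFun y := ⟨fun i => if x i ∈ frontier Ω then 0 else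
      -(1 / area Ω x i) * ∑ j ∈ neighbours Ω x i,
        faceLength Ω x i j * k (midpoint ℝ (x i) (x j)) *
          ((y.1 j - y.1 i) / dist (x i) (x j)),
    fun _ hi => if_pos hi⟩
  map_add' := by
    intro y w
    ext i
    by_cases h : x i ∈ frontier Ω
    · simp [h]
    · simp only [h, if_false, Submodule.coe_add, Pi.add_apply, ← mul_add,
        ← Finset.sum_add_distrib]
      congr 1
      refine Finset.sum_congr rfl fun j _ => ?_
      ring
  map_smul' := by
    intro c y
    ext i
    by_cases h : x i ∈ frontier Ω
    · simp [h]
    · simp only [h, if_false, Submodule.coe_smul, Pi.smul_apply, smul_eq_mul, RingHom.id_apply,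
        mul_left_comm c, Finset.mul_sum]
      refine Finset.sum_congr rfl fun j _ => ?_
      ring

/-- The discrete Laplace operator `Λ`: the operator of diffusive transport with `k = 1`. -/
def laplace {M : ℕ} (Ω : Set Plane) (x : Fin M → Plane) : gridSpace Ω x →ₗ[ℝ] gridSpace Ω x :=
  diffusion Ω x fun _ => 1

end VoronoiFV

end

/-!
The proof compares a grid function `y` with the quadratic function
`φ p = ∑ α, (p α - a α) (b α - p α) / 2`, which is positive on `Ω` and at most `2 M₀`
(`comparison_le`). On a Voronoi grid the discrete Laplacian is exact on quadratic functions of this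
shape: `-Λφ = 2` at every interior node (`sum_transmissibility_comparison`). Barta's argument
(`barta`), that is, summation by parts and Picone's inequality
`(y_j - y_i)² ≥ (φ_j - φ_i) (y_j² / φ_j - y_i² / φ_i)`, then yields
`(Λy, y) ≥ ∑ V_i (-Λφ)_i y_i² / φ_i ≥ ‖y‖² / M₀`.

The exactness of `Λ` on `φ` rests on two facts about the closed Voronoi polygon of an interior node:
its normals weighted by side lengths sum to zero (`sum_faceLength_normal`), and four times its area
is `∑ l_ij d_ij` (`area_eq`). Both follow from the decomposition of the polygon into triangles with
a common apex (`volume_polygon`, `area_eq_sum`): with the apex at the node the decomposition is the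
area formula, and its independence of the apex is the relation between the normals. The faces
`∂Ω_i ∩ ∂Ω_j` of an interior node are exactly the sides of its closed Voronoi polygon (`face_eq`).

Symmetry of the diffusion operator is summation by parts (`ip_diffusion`), and its lower bound
follows from the case `k = 1`, because the midpoint of an interior node and any other node lies in
`Ω`, where `κ ≤ k` (`mul_transmissibility_le`).
-/

noncomputable section

namespace VoronoiFV

open MeasureTheory Set
open scoped RealInnerProductSpace

/-! ### The area of a convex polygon -/

/-- The triangle (or cone) with apex `0` cut out of a cone `K` by the line `⟪w, p⟫ = 1`, which has
distance `1 / ‖w‖` from the origin, has area one half of height times base. -/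
lemma volume_cone {w : Plane} (hw : w ≠ 0) {K : Set Plane} (hK : MeasurableSet K)
    (hcone : ∀ t : ℝ, 0 < t → ∀ p ∈ K, t • p ∈ K) :
    volume {p | p ∈ K ∧ 0 ≤ ⟪w, p⟫ ∧ ⟪w, p⟫ ≤ 1} =
      ENNReal.ofReal (1 / (2 * ‖w‖)) * μH[1] {p | p ∈ K ∧ ⟪w, p⟫ = 1} := by
  have hN : 0 < ‖w‖ := norm_pos_iff.2 hw
  obtain ⟨b, hb⟩ : ∃ b : OrthonormalBasis (Fin 2) ℝ Plane, ∀ i ∈ ({0} : Set (Fin 2)),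
      b i = (fun _ => ‖w‖⁻¹ • w) i := by
    refine Orthonormal.exists_orthonormalBasis_extension_of_card_eq (by simp) ⟨?_, ?_⟩
    · rintro ⟨i, hi⟩
      simp [norm_smul, hN.ne']
    · rintro ⟨i, hi⟩ ⟨j, hj⟩ hij
      exact absurd (Subtype.ext (hi.trans hj.symm)) hij
  have hb0 : b 0 = ‖w‖⁻¹ • w := hb 0 rfl
  have hwb : w = ‖w‖ • b 0 := by rw [hb0, smul_smul, mul_inv_cancel₀ hN.ne', one_smul]
  -- coordinates in which the first axis is orthogonal to the base of the cone
  let Φ : ℝ × ℝ → Plane := fun z =>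
    b.repr.symm (WithLp.toLp 2 (MeasurableEquiv.finTwoArrow.symm z))
  have hΦ : MeasurePreserving Φ volume volume :=
    b.measurePreserving_repr_symm.comp ((PiLp.volume_preserving_toLp (Fin 2)).comp
      (volume_preserving_finTwoArrow ℝ).symm)
  have hΦe : ∀ u v, Φ (u, v) = u • b 0 + v • b 1 := by
    intro u v
    simp only [Φ, ← b.sum_repr_symm, Fin.sum_univ_two]
    rfl
  have hin : ∀ u v, ⟪w, Φ (u, v)⟫ = ‖w‖ * u := by
    intro u v
    have h1 : ⟪b 0, b 1⟫ = 0 := b.orthonormal.2 (by decide)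
    have h0 : ⟪b 0, b 0⟫ = 1 := by simp
    rw [hΦe]
    nth_rw 1 [hwb]
    simp only [inner_smul_left, inner_add_right, inner_smul_right, h1, h0]
    simp [mul_comm]
  have hΦs : ∀ t u v, Φ (t * u, t * v) = t • Φ (u, v) := by
    intro t u v
    simp only [hΦe, smul_add, smul_smul]
  set h : ℝ := ‖w‖⁻¹ with hh
  have hpos : 0 < h := inv_pos.2 hN
  set S : Set ℝ := {v | Φ (h, v) ∈ K} with hS
  have hbase : μH[1] {p | p ∈ K ∧ ⟪w, p⟫ = 1} = volume S := by
    have hiso : Isometry (fun v => Φ (h, v)) := by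
      refine Isometry.of_dist_eq fun v v' => ?_
      rw [hΦe, hΦe, dist_add_left, dist_eq_norm, ← sub_smul, norm_smul, b.norm_eq_one, mul_one,
        Real.dist_eq, Real.norm_eq_abs]
    rw [← hausdorffMeasure_real, ← hiso.hausdorffMeasure_image (Or.inl zero_le_one)]
    congr 1
    ext p
    constructor
    · rintro ⟨hpK, hp⟩
      have hpe : p = Φ (b.repr p 0, b.repr p 1) := by
        rw [hΦe, ← Fin.sum_univ_two (f := fun i => b.repr p i • b i), b.sum_repr]
      have : b.repr p 0 = h := by
        rw [hpe, hin] at hp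
        rw [hh]
        field_simp
        linarith
      rw [this] at hpe
      refine ⟨b.repr p 1, ?_, hpe.symm⟩
      rw [hS, mem_ofPred_eq, ← hpe]
      exact hpK
    · rintro ⟨v, hv, rfl⟩
      refine ⟨hv, ?_⟩
      rw [hin, hh, mul_inv_cancel₀ hN.ne']
  have hmeas : MeasurableSet {p : Plane | p ∈ K ∧ 0 ≤ ⟪w, p⟫ ∧ ⟪w, p⟫ ≤ 1} := by
    have h1 : Measurable fun p : Plane => ⟪w, p⟫ := by fun_prop
    exact hK.inter ((measurableSet_le measurable_const h1).inter
      (measurableSet_le h1 measurable_const))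
  have hslice : ∀ u : ℝ, u ≠ 0 →
      volume (Prod.mk u ⁻¹' (Φ ⁻¹' {p | p ∈ K ∧ 0 ≤ ⟪w, p⟫ ∧ ⟪w, p⟫ ≤ 1})) =
        (Ioc 0 h).indicator (fun u => ENNReal.ofReal (u / h) * volume S) u := by
    intro u hu
    by_cases hmem : u ∈ Ioc 0 h
    · rw [indicator_of_mem hmem]
      have hu0 : 0 < u := hmem.1
      have : Prod.mk u ⁻¹' (Φ ⁻¹' {p | p ∈ K ∧ 0 ≤ ⟪w, p⟫ ∧ ⟪w, p⟫ ≤ 1}) =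
          (fun v => h / u * v) ⁻¹' S := by
        have hs : ∀ v, Φ (h, h / u * v) = (h / u) • Φ (u, v) := by
          intro v
          rw [← hΦs, div_mul_cancel₀ _ hu]
        ext v
        simp only [mem_preimage, mem_ofPred_eq, hin, hS, hs]
        constructor
        · rintro ⟨hk, -⟩
          exact hcone _ (by positivity) _ hk
        · intro hk
          refine ⟨?_, by positivity, ?_⟩
          · have := hcone (u / h) (by positivity) _ hk
            rwa [smul_smul, div_mul_div_cancel₀ hpos.ne', div_self hu, one_smul] at this
          · calc ‖w‖ * u ≤ ‖w‖ * h := by gcongr; exact hmem.2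
              _ = 1 := mul_inv_cancel₀ hN.ne'
      rw [this, Real.volume_preimage_mul_left (by positivity), inv_div, abs_of_pos (by positivity)]
    · rw [indicator_of_notMem hmem]
      convert measure_empty (μ := (volume : Measure ℝ))
      rw [eq_empty_iff_forall_notMem]
      rintro v ⟨-, h1, h2⟩
      rw [hin] at h1 h2
      refine hmem ⟨lt_of_le_of_ne (nonneg_of_mul_nonneg_right h1 hN) (Ne.symm hu), ?_⟩
      rw [hh, ← one_div, le_div_iff₀ hN]
      linarith
  rw [hbase, ← hΦ.measure_preimage hmeas.nullMeasurableSet, Measure.volume_eq_prod,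
    Measure.prod_apply (hΦ.measurable hmeas)]
  have hae : (fun u : ℝ =>
      volume (Prod.mk u ⁻¹' (Φ ⁻¹' {p | p ∈ K ∧ 0 ≤ ⟪w, p⟫ ∧ ⟪w, p⟫ ≤ 1}))) =ᵐ[volume]
      (Ioc 0 h).indicator (fun u => ENNReal.ofReal (u / h) * volume S) := by
    filter_upwards [Measure.ae_ne volume (0 : ℝ)] with u hu using hslice u hu
  rw [lintegral_congr_ae hae, lintegral_indicator measurableSet_Ioc,
    lintegral_mul_const _ (by fun_prop)]
  congr 1
  rw [← ofReal_integral_eq_lintegral_ofReal]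
  · rw [← intervalIntegral.integral_of_le hpos.le, intervalIntegral.integral_div, integral_id, hh]
    congr 1
    field_simp
    ring
  · exact (Continuous.integrableOn_Icc (by fun_prop)).mono_set Ioc_subset_Icc_self
  · filter_upwards [ae_restrict_mem measurableSet_Ioc] with u hu
    exact div_nonneg hu.1.le hpos.le

lemma volume_inner_eq_zero {w : Plane} (hw : w ≠ 0) : volume {p : Plane | ⟪w, p⟫ = 0} = 0 := by
  have h := Measure.addHaar_submodule (volume : Measure Plane) (innerSL ℝ w).toLinearMap.ker
    (fun h => hw ?_)
  · rw [← h]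
    congr 1
  · have : w ∈ (innerSL ℝ w).toLinearMap.ker := h ▸ Submodule.mem_top
    simpa using this

/-- A bounded polygon `⟪w j, p⟫ ≤ 1` is the union of the triangles spanned by the origin and its
edges; the edge `j` has distance `1 / ‖w j‖` from the origin. As the `w j` are distinct, the
triangles overlap in null sets only. -/
theorem volume_polygon {ι : Type*} (s : Finset ι) (w : ι → Plane) (hw : ∀ j ∈ s, w j ≠ 0)
    (hinj : Set.InjOn w s) (hbd : Bornology.IsBounded {p : Plane | ∀ j ∈ s, ⟪w j, p⟫ ≤ 1}) :
    volume {p : Plane | ∀ j ∈ s, ⟪w j, p⟫ ≤ 1} =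
      ∑ j ∈ s, ENNReal.ofReal (1 / (2 * ‖w j‖)) *
        μH[1] {p | (∀ k ∈ s, ⟪w k, p⟫ ≤ 1) ∧ ⟪w j, p⟫ = 1} := by
  have hmz : ∀ j, Measurable fun p : Plane => ⟪w j, p⟫ := fun j => by fun_prop
  -- the cone of points that see the edge `j` from the origin
  let K : ι → Set Plane := fun j => {p | ∀ k ∈ s, ⟪w k, p⟫ ≤ ⟪w j, p⟫}
  have hKm : ∀ j, MeasurableSet (K j) := by
    intro j
    have : K j = ⋂ k ∈ s, {p | ⟪w k, p⟫ ≤ ⟪w j, p⟫} := by ext; simp [K]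
    rw [this]
    exact Finset.measurableSet_biInter s fun k _ => measurableSet_le (hmz k) (hmz j)
  have hKc : ∀ j, ∀ t : ℝ, 0 < t → ∀ p ∈ K j, t • p ∈ K j := by
    intro j t ht p hp k hk
    rw [inner_smul_right, inner_smul_right]
    exact mul_le_mul_of_nonneg_left (hp k hk) ht.le
  let A : ι → Set Plane := fun j => {p | p ∈ K j ∧ 0 ≤ ⟪w j, p⟫ ∧ ⟪w j, p⟫ ≤ 1}
  have hAm : ∀ j, MeasurableSet (A j) := fun j => (hKm j).inter
    ((measurableSet_le measurable_const (hmz j)).inter (measurableSet_le (hmz j) measurable_const))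
  have hne : s.Nonempty := by
    by_contra h
    rw [Finset.not_nonempty_iff_eq_empty] at h
    subst h
    exact NormedSpace.unbounded_univ ℝ Plane (by simpa using hbd)
  have hunion : {p : Plane | ∀ j ∈ s, ⟪w j, p⟫ ≤ 1} = ⋃ j ∈ s, A j := by
    ext p
    simp only [mem_iUnion, exists_prop]
    constructor
    · intro hp
      obtain ⟨j, hj, hmax⟩ := s.exists_max_image (fun j => ⟪w j, p⟫) hne
      refine ⟨j, hj, hmax, ?_, hp j hj⟩
      by_contra! hneg
      -- otherwise the polygon contains the ray through `p`
      obtain ⟨C, hC⟩ := hbd.exists_norm_le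
      have hp0 : 0 < ‖p‖ := by
        rw [norm_pos_iff]
        rintro rfl
        simp at hneg
      have hmem : ((|C| + 1) / ‖p‖) • p ∈ {p : Plane | ∀ j ∈ s, ⟪w j, p⟫ ≤ 1} := by
        intro k hk
        rw [inner_smul_right]
        have h1 : ⟪w k, p⟫ ≤ 0 := (hmax k hk).trans hneg.le
        have h2 : 0 ≤ (|C| + 1) / ‖p‖ := by positivity
        nlinarith
      have := hC _ hmem
      rw [norm_smul, Real.norm_of_nonneg (by positivity), div_mul_cancel₀ _ hp0.ne'] at this
      linarith [le_abs_self C]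
    · rintro ⟨j, hj, hK, -, h1⟩ k hk
      exact (hK k hk).trans h1
  have hdisj : (s : Set ι).Pairwise (Function.onFun (AEDisjoint volume) A) := by
    intro j hj k hk hjk
    refine measure_mono_null ?_
      (volume_inner_eq_zero (sub_ne_zero.2 fun h => hjk (hinj hj hk h)))
    rintro p ⟨⟨h1, -⟩, h2, -⟩
    rw [mem_ofPred_eq, inner_sub_left]
    linarith [h1 k hk, h2 j hj]
  rw [hunion, measure_biUnion_finset₀ hdisj fun j _ => (hAm j).nullMeasurableSet]
  refine Finset.sum_congr rfl fun j hj => ?_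
  rw [volume_cone (hw j hj) (hKm j) (hKc j)]
  congr 2
  ext p
  constructor
  · rintro ⟨h1, h2⟩
    exact ⟨fun k hk => h2 ▸ h1 k hk, h2⟩
  · rintro ⟨h1, h2⟩
    exact ⟨fun k hk => h2.symm ▸ h1 k hk, h2⟩

/-! ### Voronoi cells -/

variable {M : ℕ} {Ω : Set Plane} {x : Fin M → Plane} {i j : Fin M}

/-- The closed Voronoi polygon of `x i`: the points for which `x i` is a nearest node. -/
def closedCell {M : ℕ} (x : Fin M → Plane) (i : Fin M) : Set Plane :=
  {p | ∀ j, j ≠ i → dist p (x i) ≤ dist p (x j)}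

/-- The difference of the squared distances to two points is an affine function. -/
lemma dist_sq_sub_dist_sq (p q u v : Plane) :
    dist p v ^ 2 - dist p u ^ 2 = dist q v ^ 2 - dist q u ^ 2 - 2 * ⟪v - u, p - q⟫ := by
  simp only [EuclideanSpace.dist_sq_eq, Fin.sum_univ_two, Real.dist_eq, sq_abs,
    PiLp.inner_apply, PiLp.sub_apply, RCLike.inner_apply, conj_trivial]
  ring

lemma dist_sq_sub_combo (p q u v : Plane) {a b : ℝ} (hab : a + b = 1) :
    dist (a • p + b • q) v ^ 2 - dist (a • p + b • q) u ^ 2 =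
      a * (dist p v ^ 2 - dist p u ^ 2) + b * (dist q v ^ 2 - dist q u ^ 2) := by
  obtain rfl : b = 1 - a := by linarith
  simp only [EuclideanSpace.dist_sq_eq, Fin.sum_univ_two, Real.dist_eq, sq_abs,
    PiLp.add_apply, PiLp.smul_apply, smul_eq_mul]
  ring

lemma voronoi_subset_closedCell : voronoi x i ⊆ closedCell x i :=
  fun _ hp j hj => (hp j hj).le

lemma isOpen_voronoi : IsOpen (voronoi x i) := by
  have : voronoi x i = ⋂ j, ⋂ (_ : j ≠ i), {p | dist p (x i) < dist p (x j)} := by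
    ext
    simp [voronoi]
  rw [this]
  exact isOpen_iInter_of_finite fun j => isOpen_iInter_of_finite fun _ =>
    isOpen_lt (by fun_prop) (by fun_prop)

lemma isClosed_closedCell : IsClosed (closedCell x i) := by
  have : closedCell x i = ⋂ j, ⋂ (_ : j ≠ i), {p | dist p (x i) ≤ dist p (x j)} := by
    ext
    simp [closedCell]
  rw [this]
  exact isClosed_iInter fun j => isClosed_iInter fun _ =>
    isClosed_le (by fun_prop) (by fun_prop)

lemma mem_voronoi_self (hx : Function.Injective x) (i : Fin M) : x i ∈ voronoi x i := by
  intro j hj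
  rw [dist_self, dist_pos]
  exact fun h => hj (hx h).symm

lemma combo_mem_voronoi {p q : Plane} (hp : p ∈ closedCell x i) (hq : q ∈ voronoi x i) {a b : ℝ}
    (ha : 0 ≤ a) (hb : 0 < b) (hab : a + b = 1) : a • p + b • q ∈ voronoi x i := by
  intro j hj
  have h1 := pow_le_pow_left₀ dist_nonneg (hp j hj) 2
  have h2 := pow_lt_pow_left₀ (hq j hj) dist_nonneg two_ne_zero
  refine lt_of_pow_lt_pow_left₀ 2 dist_nonneg ?_
  have h3 := dist_sq_sub_combo p q (x i) (x j) hab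
  have h4 : 0 ≤ a * (dist p (x j) ^ 2 - dist p (x i) ^ 2) := mul_nonneg ha (by linarith)
  have h5 : 0 < b * (dist q (x j) ^ 2 - dist q (x i) ^ 2) := mul_pos hb (by linarith)
  linarith

lemma convex_voronoi : Convex ℝ (voronoi x i) := by
  rw [convex_iff_forall_pos]
  intro p hp q hq a b ha hb hab
  exact combo_mem_voronoi (voronoi_subset_closedCell hp) hq ha.le hb hab

lemma mem_closure_controlVolume (hΩ : Convex ℝ Ω) (hΩo : IsOpen Ω) (hx : Function.Injective x)
    (hi : x i ∈ closure Ω) {p : Plane} (hp : p ∈ closedCell x i) (hpΩ : p ∈ closure Ω) :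
    p ∈ closure (controlVolume Ω x i) := by
  obtain ⟨q, hqv, hqΩ⟩ := mem_closure_iff.1 hi _ isOpen_voronoi (mem_voronoi_self hx i)
  have hsub : openSegment ℝ p q ⊆ controlVolume Ω x i := by
    intro z hz
    refine ⟨?_, ?_⟩
    · obtain ⟨a, b, ha, hb, hab, rfl⟩ := hz
      exact combo_mem_voronoi hp hqv ha.le hb hab
    · rw [openSegment_symm] at hz
      exact interior_subset (hΩ.openSegment_interior_closure_subset_interior
        (hΩo.interior_eq.symm ▸ hqΩ) hpΩ hz)
  exact closure_mono hsub (segment_subset_closure_openSegment (left_mem_segment ℝ p q))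

lemma closure_controlVolume_subset : closure (controlVolume Ω x i) ⊆ closedCell x i :=
  closure_minimal (inter_subset_left.trans voronoi_subset_closedCell) isClosed_closedCell

lemma closure_voronoi (hx : Function.Injective x) : closure (voronoi x i) = closedCell x i := by
  refine (closure_minimal voronoi_subset_closedCell isClosed_closedCell).antisymm fun p hp => ?_
  have := mem_closure_controlVolume (Ω := univ) convex_univ isOpen_univ hx (by simp) hp (by simp)
  simpa [controlVolume] using this

lemma voronoi_disjoint_closedCell (hij : i ≠ j) {p : Plane} (hi : p ∈ voronoi x i) :
    p ∉ closedCell x j :=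
  fun hj => (hi j hij.symm).not_ge (hj i hij)

/-- The faces of an untruncated control volume are the edges of the closed Voronoi polygon. This
holds even if the neighbour `j` is a boundary node, whose own control volume is truncated. -/
lemma face_eq (hΩ : Convex ℝ Ω) (hΩo : IsOpen Ω) (hx : Function.Injective x)
    (hcl : ∀ i, x i ∈ closure Ω) (hV : voronoi x i ⊆ Ω) (hij : i ≠ j) :
    face Ω x i j = closedCell x i ∩ closedCell x j := by
  have hopen : ∀ k, IsOpen (controlVolume Ω x k) := fun k => isOpen_voronoi.inter hΩo
  rw [face, (hopen i).frontier_eq, (hopen j).frontier_eq]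
  refine Subset.antisymm (fun p hp => ⟨closure_controlVolume_subset hp.1.1,
    closure_controlVolume_subset hp.2.1⟩) ?_
  rintro p ⟨hpi, hpj⟩
  have hpΩ : p ∈ closure Ω := closure_mono hV (by rwa [closure_voronoi hx])
  exact ⟨⟨mem_closure_controlVolume hΩ hΩo hx (hcl i) hpi hpΩ,
    fun h => voronoi_disjoint_closedCell hij h.1 hpj⟩,
    mem_closure_controlVolume hΩ hΩo hx (hcl j) hpj hpΩ,
    fun h => voronoi_disjoint_closedCell hij.symm h.1 hpi⟩

lemma faceLength_comm : faceLength Ω x i j = faceLength Ω x j i := by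
  rw [faceLength, faceLength, face, face, inter_comm]

/-- Decomposition of a control volume into triangles with common apex `q`, for an arbitrary
point `q` of the control volume: the distance from `q` to the face between the nodes `i` and `j` is
`(|q - x_j|² - |q - x_i|²) / (2 d_ij)`. -/
lemma area_eq_sum (hΩ : Convex ℝ Ω) (hΩo : IsOpen Ω) (hb : Bornology.IsBounded Ω)
    (hx : Function.Injective x) (hcl : ∀ i, x i ∈ closure Ω) (hV : voronoi x i ⊆ Ω)
    {q : Plane} (hq : q ∈ voronoi x i) :
    area Ω x i = ∑ j ∈ Finset.univ.erase i,
      (dist q (x j) ^ 2 - dist q (x i) ^ 2) / (4 * dist (x i) (x j)) * faceLength Ω x i j := by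
  let c : Fin M → ℝ := fun j => (dist q (x j) ^ 2 - dist q (x i) ^ 2) / 2
  have hc : ∀ j ≠ i, 0 < c j := fun j hj =>
    half_pos (sub_pos.2 (pow_lt_pow_left₀ (hq j hj) dist_nonneg two_ne_zero))
  let w : Fin M → Plane := fun j => (c j)⁻¹ • (x j - x i)
  have hne : ∀ j ≠ i, x j - x i ≠ 0 := fun j hj => sub_ne_zero.2 fun h => hj (hx h)
  have hw : ∀ j ≠ i, w j ≠ 0 := fun j hj => smul_ne_zero (inv_ne_zero (hc j hj).ne') (hne j hj)
  -- with `q` as origin, `w j` is the vertex dual to the edge between the nodes `i` and `j`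
  have hin : ∀ j ≠ i, ∀ p, 1 - ⟪w j, p⟫ =
      (dist (q + p) (x j) ^ 2 - dist (q + p) (x i) ^ 2) / (2 * c j) := by
    intro j hj p
    have h1 := dist_sq_sub_dist_sq (q + p) q (x i) (x j)
    have h2 := (hc j hj).ne'
    rw [add_sub_cancel_left] at h1
    rw [h1, inner_smul_left, conj_trivial]
    field_simp
    simp only [c]
    ring
  have hle : ∀ j ≠ i, ∀ p, ⟪w j, p⟫ ≤ 1 ↔ dist (q + p) (x i) ≤ dist (q + p) (x j) := by
    intro j hj p
    rw [← sub_nonneg, hin j hj, le_div_iff₀ (mul_pos two_pos (hc j hj)), zero_mul, sub_nonneg,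
      pow_le_pow_iff_left₀ dist_nonneg dist_nonneg two_ne_zero]
  have heq : ∀ j ≠ i, ∀ p, ⟪w j, p⟫ = 1 ↔ dist (q + p) (x i) = dist (q + p) (x j) := by
    intro j hj p
    rw [eq_comm, ← sub_eq_zero, hin j hj, div_eq_zero_iff,
      or_iff_left (mul_pos two_pos (hc j hj)).ne', sub_eq_zero,
      pow_left_inj₀ dist_nonneg dist_nonneg two_ne_zero, eq_comm]
  have hinj : Set.InjOn w (Finset.univ.erase i : Finset (Fin M)) := by
    intro j hj k hk hjk
    have hj : j ≠ i := by simpa using hj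
    have hk : k ≠ i := by simpa using hk
    have hcj := hc j hj
    have hck := hc k hk
    -- `x j - x i = t • (x k - x i)`, and evaluating `c` with this relation gives `t ^ 2 = t`
    obtain ⟨t, ht0, ht, htc⟩ : ∃ t : ℝ, t ≠ 0 ∧ x j - x i = t • (x k - x i) ∧ c j = t * c k := by
      refine ⟨c j / c k, by positivity, ?_, by field_simp⟩
      have := congrArg (fun v => c j • v) hjk
      simpa only [w, smul_smul, mul_inv_cancel₀ hcj.ne', one_smul, div_eq_mul_inv] using this
    have hcv : ∀ m, c m = ⟪x m - x i, x m - x i⟫ / 2 - ⟪x m - x i, q - x i⟫ := by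
      intro m
      have := dist_sq_sub_dist_sq q (x i) (x i) (x m)
      rw [dist_self, dist_comm (x i), dist_eq_norm (x m), ← real_inner_self_eq_norm_sq] at this
      simp only [c]
      linarith
    have h1 := hcv j
    rw [ht, htc, hcv k] at h1
    simp only [inner_smul_left, inner_smul_right, conj_trivial] at h1
    have h2 : 0 < ⟪x k - x i, x k - x i⟫ := real_inner_self_pos.2 (hne k hk)
    have h3 : t * (t - 1) * ⟪x k - x i, x k - x i⟫ = 0 := by linarith
    have h4 : t = 1 := by
      rcases mul_eq_zero.1 h3 with h | h
      · linarith [(mul_eq_zero.1 h).resolve_left ht0]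
      · exact absurd h h2.ne'
    rw [h4, one_smul] at ht
    exact hx (sub_left_injective ht)
  have hpoly : {p : Plane | ∀ j ∈ Finset.univ.erase i, ⟪w j, p⟫ ≤ 1} =
      (fun p => q + p) ⁻¹' closedCell x i := by
    ext p
    simp only [Finset.mem_erase, Finset.mem_univ, and_true, mem_preimage, closedCell, mem_ofPred_eq]
    exact forall₂_congr fun j hj => hle j hj p
  have hedge : ∀ j ∈ Finset.univ.erase i,
      μH[1] {p | (∀ k ∈ Finset.univ.erase i, ⟪w k, p⟫ ≤ 1) ∧ ⟪w j, p⟫ = 1} =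
        μH[1] (face Ω x i j) := by
    intro j hj
    have hj : j ≠ i := by simpa using hj
    rw [face_eq hΩ hΩo hx hcl hV hj.symm,
      ← (IsometryEquiv.addLeft q).hausdorffMeasure_preimage 1 (closedCell x i ∩ closedCell x j)]
    congr 1
    ext p
    have h1 : (∀ k ∈ Finset.univ.erase i, ⟪w k, p⟫ ≤ 1) ↔ q + p ∈ closedCell x i :=
      Set.ext_iff.1 hpoly p
    rw [mem_ofPred_eq, h1, heq j hj]
    refine and_congr_right fun hpi => ⟨fun h k hk => ?_, fun h => ?_⟩
    · rw [IsometryEquiv.addLeft_apply, ← h]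
      by_cases hki : k = i
      · rw [hki]
      · exact hpi k hki
    · exact (hpi j hj).antisymm (h i hj.symm)
  have hclb : Bornology.IsBounded (closedCell x i) := by
    rw [← closure_voronoi hx]
    exact (hb.subset hV).closure
  have hpb : Bornology.IsBounded {p : Plane | ∀ j ∈ Finset.univ.erase i, ⟪w j, p⟫ ≤ 1} := by
    rw [hpoly]
    exact (IsometryEquiv.addLeft q).isometry.antilipschitz.isBounded_preimage hclb
  have hvol := volume_polygon (Finset.univ.erase i) w (fun j hj => hw j (by simpa using hj)) hinj hpb
  have hfin := hpb.measure_lt_top (μ := volume)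
  rw [hvol] at hfin
  have harea : volume (controlVolume Ω x i) =
      volume {p : Plane | ∀ j ∈ Finset.univ.erase i, ⟪w j, p⟫ ≤ 1} := by
    rw [hpoly, measure_preimage_add, ← closure_voronoi hx, controlVolume,
      inter_eq_left.2 hV, measure_closure_of_null_frontier (convex_voronoi.addHaar_frontier _)]
  rw [area, harea, hvol, ENNReal.toReal_sum fun j hj => (ENNReal.sum_lt_top.1 hfin j hj).ne]
  refine Finset.sum_congr rfl fun j hj => ?_
  rw [hedge j hj, ENNReal.toReal_mul, ENNReal.toReal_ofReal (by positivity), faceLength]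
  have hj : j ≠ i := by simpa using hj
  congr 1
  simp only [w, norm_smul, norm_inv, Real.norm_of_nonneg (hc j hj).le]
  rw [dist_comm (x i), dist_eq_norm (x j)]
  have h1 := norm_pos_iff.2 (hne j hj)
  have h2 := hc j hj
  have h3 : dist q (x j) ^ 2 - dist q (x i) ^ 2 = 2 * c j := by simp only [c]; ring
  rw [h3]
  field_simp
  ring

/-- Four times the area of a control volume is `∑ l_ij d_ij`: the face between the nodes `i` and `j`
lies halfway between them. -/
lemma area_eq (hΩ : Convex ℝ Ω) (hΩo : IsOpen Ω) (hb : Bornology.IsBounded Ω)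
    (hx : Function.Injective x) (hcl : ∀ i, x i ∈ closure Ω) (hV : voronoi x i ⊆ Ω) :
    area Ω x i = ∑ j, faceLength Ω x i j * dist (x i) (x j) / 4 := by
  rw [area_eq_sum hΩ hΩo hb hx hcl hV (mem_voronoi_self hx i),
    ← Finset.sum_erase Finset.univ (a := i) (by simp)]
  refine Finset.sum_congr rfl fun j hj => ?_
  have : dist (x i) (x j) ≠ 0 := dist_ne_zero.2 fun h => Finset.ne_of_mem_erase hj (hx h).symm
  rw [dist_self]
  field_simp
  ring

/-- The unit normals of a closed polygon, weighted by the lengths of its sides, sum to zero: the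
area formula does not depend on the position of the apex. -/
lemma sum_faceLength_normal (hΩ : Convex ℝ Ω) (hΩo : IsOpen Ω) (hb : Bornology.IsBounded Ω)
    (hx : Function.Injective x) (hcl : ∀ i, x i ∈ closure Ω) (hV : voronoi x i ⊆ Ω) :
    ∑ j, (faceLength Ω x i j / dist (x i) (x j)) • (x j - x i) = 0 := by
  set N := ∑ j, (faceLength Ω x i j / dist (x i) (x j)) • (x j - x i) with hN
  have hkey : ∀ q ∈ voronoi x i, ⟪N, q - x i⟫ = 0 := by
    intro q hq
    have h1 := area_eq_sum hΩ hΩo hb hx hcl hV hq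
    rw [area_eq_sum hΩ hΩo hb hx hcl hV (mem_voronoi_self hx i), ← sub_eq_zero,
      ← Finset.sum_sub_distrib] at h1
    have h2 : ⟪N, q - x i⟫ = 2 * ∑ j ∈ Finset.univ.erase i,
        ((dist (x i) (x j) ^ 2 - dist (x i) (x i) ^ 2) / (4 * dist (x i) (x j)) *
          faceLength Ω x i j -
        (dist q (x j) ^ 2 - dist q (x i) ^ 2) / (4 * dist (x i) (x j)) * faceLength Ω x i j) := by
      rw [hN, sum_inner, ← Finset.sum_erase Finset.univ (a := i) (by simp), Finset.mul_sum]
      refine Finset.sum_congr rfl fun j hj => ?_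
      have : dist (x i) (x j) ≠ 0 := dist_ne_zero.2 fun h => Finset.ne_of_mem_erase hj (hx h).symm
      rw [dist_sq_sub_dist_sq q (x i) (x i) (x j), inner_smul_left, conj_trivial]
      field_simp
      ring
    rw [h2, h1, mul_zero]
  obtain ⟨ε, hε, hball⟩ := Metric.isOpen_iff.1 isOpen_voronoi _ (mem_voronoi_self hx i)
  by_contra hne
  have hpos : 0 < ‖N‖ := norm_pos_iff.2 hne
  have h := hkey (x i + (ε / 2 / ‖N‖) • N) (hball (by
    rw [Metric.mem_ball, dist_self_add_left, norm_smul, Real.norm_of_nonneg (by positivity),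
      div_mul_cancel₀ _ hpos.ne']
    exact half_lt_self hε))
  rw [add_sub_cancel_left, inner_smul_right] at h
  have : 0 < ε / 2 / ‖N‖ * ⟪N, N⟫ := mul_pos (by positivity) (real_inner_self_pos.2 hne)
  exact this.ne' h

lemma area_pos (hb : Bornology.IsBounded Ω) (hΩo : IsOpen Ω) (hx : Function.Injective x)
    (hi : x i ∈ Ω) : 0 < area Ω x i :=
  ENNReal.toReal_pos
    ((isOpen_voronoi.inter hΩo).measure_pos volume ⟨x i, mem_voronoi_self hx i, hi⟩).ne'
    (hb.subset inter_subset_right).measure_lt_top.ne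

/-! ### Summation by parts and Picone's inequality -/

lemma sum_sum_mul_sub_mul_sub {ι : Type*} [Fintype ι] {a : ι → ι → ℝ}
    (ha : ∀ i j, a i j = a j i) (u w : ι → ℝ) :
    ∑ i, ∑ j, a i j * (u j - u i) * (w j - w i) =
      -2 * ∑ i, (∑ j, a i j * (u j - u i)) * w i := by
  have h1 : ∑ i, ∑ j, a i j * (u j - u i) * (w j - w i) =
      ∑ i, ∑ j, a i j * (u j - u i) * w j - ∑ i, ∑ j, a i j * (u j - u i) * w i := by
    simp only [← Finset.sum_sub_distrib, mul_sub]
  have h2 : ∑ i, ∑ j, a i j * (u j - u i) * w j = -∑ i, ∑ j, a i j * (u j - u i) * w i := by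
    rw [Finset.sum_comm]
    simp only [← Finset.sum_neg_distrib]
    refine Finset.sum_congr rfl fun i _ => Finset.sum_congr rfl fun j _ => ?_
    rw [ha j i]
    ring
  simp only [Finset.sum_mul]
  rw [h1, h2]
  ring

/-- Picone's inequality `|∇y|² ≥ ∇φ · ∇(y² / φ)` for two adjacent nodes, where `z = y² / φ`. -/
lemma mul_sub_le_sq_sub {φ₁ φ₂ y₁ y₂ z₁ z₂ : ℝ} (hφ₁ : 0 ≤ φ₁) (hφ₂ : 0 ≤ φ₂) (hz₁ : 0 ≤ z₁)
    (hz₂ : 0 ≤ z₂) (h₁ : z₁ * φ₁ = y₁ ^ 2) (h₂ : z₂ * φ₂ = y₂ ^ 2) :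
    (φ₂ - φ₁) * (z₂ - z₁) ≤ (y₂ - y₁) ^ 2 := by
  have h : 2 * (y₁ * y₂) ≤ φ₂ * z₁ + φ₁ * z₂ := by
    refine (abs_le_of_sq_le_sq' ?_ (by positivity)).2
    have : (y₁ * y₂) ^ 2 = φ₂ * z₁ * (φ₁ * z₂) := by rw [mul_pow, ← h₁, ← h₂]; ring
    rw [mul_pow, this]
    nlinarith [sq_nonneg (φ₂ * z₁ - φ₁ * z₂)]
  linarith

/-- Barta's lower bound for the Dirichlet form by means of a nonnegative function `φ`. The quotient
`y² / φ` has the junk value `0` at the zeros of `φ`, where `y` is assumed to vanish. -/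
lemma barta {ι : Type*} [Fintype ι] {a : ι → ι → ℝ} (ha : ∀ i j, a i j = a j i)
    (ha0 : ∀ i j, 0 ≤ a i j) {φ y : ι → ℝ} (hφ : ∀ i, 0 ≤ φ i) (hy : ∀ i, φ i = 0 → y i = 0) :
    -2 * ∑ i, (∑ j, a i j * (φ j - φ i)) * (y i ^ 2 / φ i) ≤
      ∑ i, ∑ j, a i j * (y j - y i) * (y j - y i) := by
  rw [← sum_sum_mul_sub_mul_sub ha]
  have hz : ∀ i, y i ^ 2 / φ i * φ i = y i ^ 2 := fun i =>
    div_mul_cancel_of_imp fun h => by rw [hy i h, zero_pow two_ne_zero]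
  have hz0 : ∀ i, 0 ≤ y i ^ 2 / φ i := fun i => div_nonneg (sq_nonneg _) (hφ i)
  refine Finset.sum_le_sum fun i _ => Finset.sum_le_sum fun j _ => ?_
  rw [mul_assoc, mul_assoc, ← sq]
  exact mul_le_mul_of_nonneg_left
    (mul_sub_le_sq_sub (hφ i) (hφ j) (hz0 i) (hz0 j) (hz i) (hz j)) (ha0 i j)

/-! ### The Dirichlet form of the diffusion operator -/

lemma faceLength_nonneg (i j : Fin M) : 0 ≤ faceLength Ω x i j := ENNReal.toReal_nonneg

/-- Sums over the neighbours extend to all nodes: nodes without a common face contribute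
`l_ij = 0`. -/
lemma sum_neighbours (i : Fin M) (f g : Fin M → ℝ) (hf : ∀ j, faceLength Ω x i j = 0 → f j = 0)
    (hi : f i = 0) (hfg : ∀ j, f j = g j) : ∑ j ∈ neighbours Ω x i, f j = ∑ j, g j := by
  simp only [← hfg]
  refine Finset.sum_subset (Finset.subset_univ _) fun j _ hj => ?_
  by_cases hji : j = i
  · rw [hji, hi]
  · refine hf j ?_
    have : face Ω x i j = ∅ := by
      rw [← Set.not_nonempty_iff_eq_empty]
      exact fun h => hj (by simp [neighbours, hji, h])
    simp [faceLength, this]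

/-- The coefficient `l_ij k(x_ij) / d_ij` of the Dirichlet form. -/
def transmissibility (Ω : Set Plane) (x : Fin M → Plane) (k : Plane → ℝ) (i j : Fin M) : ℝ :=
  faceLength Ω x i j * k (midpoint ℝ (x i) (x j)) / dist (x i) (x j)

lemma transmissibility_comm (k : Plane → ℝ) (i j : Fin M) :
    transmissibility Ω x k i j = transmissibility Ω x k j i := by
  rw [transmissibility, transmissibility, faceLength_comm, midpoint_comm, dist_comm]

lemma eq_zero_of_notMem (hΩo : IsOpen Ω) (hcl : ∀ i, x i ∈ closure Ω) (y : gridSpace Ω x)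
    {i : Fin M} (hi : x i ∉ Ω) : y.1 i = 0 :=
  y.2 i (hΩo.frontier_eq ▸ ⟨hcl i, hi⟩)

lemma ip_diffusion (hΩo : IsOpen Ω) (hb : Bornology.IsBounded Ω) (hx : Function.Injective x)
    (hcl : ∀ i, x i ∈ closure Ω) (k : Plane → ℝ) (y w : gridSpace Ω x) :
    ip Ω x (diffusion Ω x k y) w =
      1 / 2 * ∑ i, ∑ j, transmissibility Ω x k i j * (y.1 j - y.1 i) * (w.1 j - w.1 i) := by
  have h1 : ip Ω x (diffusion Ω x k y) w =
      ∑ i, -((∑ j, transmissibility Ω x k i j * (y.1 j - y.1 i)) * w.1 i) := by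
    rw [ip]
    refine Finset.sum_subset_zero_on_sdiff (Finset.subset_univ _) (fun i hi => ?_) fun i hi => ?_
    · have : x i ∉ Ω := by simpa [interiorNodes] using hi
      rw [eq_zero_of_notMem hΩo hcl w this, mul_zero, neg_zero]
    · have hi : x i ∈ Ω := by simpa [interiorNodes] using hi
      have hfr : x i ∉ frontier Ω := fun h => (hΩo.frontier_eq ▸ h).2 hi
      have hA := (area_pos hb hΩo hx hi).ne'
      have hD : (diffusion Ω x k y).1 i = -(1 / area Ω x i) * ∑ j ∈ neighbours Ω x i,
          faceLength Ω x i j * k (midpoint ℝ (x i) (x j)) *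
            ((y.1 j - y.1 i) / dist (x i) (x j)) := if_neg hfr
      rw [hD, sum_neighbours i _ (fun j => transmissibility Ω x k i j * (y.1 j - y.1 i))
        (fun j hj => by rw [hj]; ring) (by simp) (fun j => by rw [transmissibility]; ring)]
      field_simp
  rw [h1, sum_sum_mul_sub_mul_sub (transmissibility_comm k), Finset.sum_neg_distrib]
  ring

lemma transmissibility_one_nonneg (i j : Fin M) :
    0 ≤ transmissibility Ω x (fun _ => 1) i j := by
  have := faceLength_nonneg (Ω := Ω) (x := x) i j
  rw [transmissibility]
  positivity

/-- The midpoint of an interior node and any other node lies in `Ω`, where `κ ≤ k`. -/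
lemma mul_transmissibility_le (hΩ : Convex ℝ Ω) (hΩo : IsOpen Ω) (hcl : ∀ i, x i ∈ closure Ω)
    {k : Plane → ℝ} {κ : ℝ} (hk : ∀ p ∈ Ω, κ ≤ k p) {i : Fin M} (hi : x i ∈ Ω) (j : Fin M) :
    κ * transmissibility Ω x (fun _ => 1) i j ≤ transmissibility Ω x k i j := by
  have hm : midpoint ℝ (x i) (x j) ∈ Ω := by
    rw [midpoint_eq_smul_add, smul_add]
    exact interior_subset (hΩ.combo_interior_closure_mem_interior
      (hΩo.interior_eq.symm ▸ hi) (hcl j) (by norm_num) (by norm_num) (by norm_num))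
  have h1 := hk _ hm
  have h2 := faceLength_nonneg (Ω := Ω) (x := x) i j
  rw [transmissibility, transmissibility, mul_one, mul_div_assoc', mul_comm κ]
  gcongr

lemma mul_ip_laplace_le (hΩ : Convex ℝ Ω) (hΩo : IsOpen Ω) (hb : Bornology.IsBounded Ω)
    (hx : Function.Injective x) (hcl : ∀ i, x i ∈ closure Ω)
    {k : Plane → ℝ} {κ : ℝ} (hk : ∀ p ∈ Ω, κ ≤ k p) (y : gridSpace Ω x) :
    κ * ip Ω x (laplace Ω x y) y ≤ ip Ω x (diffusion Ω x k y) y := by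
  rw [laplace, ip_diffusion hΩo hb hx hcl, ip_diffusion hΩo hb hx hcl, mul_left_comm]
  refine mul_le_mul_of_nonneg_left ?_ (by norm_num)
  simp only [Finset.mul_sum]
  refine Finset.sum_le_sum fun i _ => Finset.sum_le_sum fun j _ => ?_
  rw [mul_assoc, mul_assoc (transmissibility Ω x k i j), ← mul_assoc]
  by_cases hi : x i ∈ Ω
  · exact mul_le_mul_of_nonneg_right (mul_transmissibility_le hΩ hΩo hcl hk hi j)
      (mul_self_nonneg _)
  · by_cases hj : x j ∈ Ω
    · rw [transmissibility_comm, transmissibility_comm k]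
      exact mul_le_mul_of_nonneg_right (mul_transmissibility_le hΩ hΩo hcl hk hj i)
        (mul_self_nonneg _)
    · rw [eq_zero_of_notMem hΩo hcl y hi, eq_zero_of_notMem hΩo hcl y hj]
      simp

/-! ### The comparison function -/

/-- The quadratic comparison function of the rectangle `[a 0, b 0] × [a 1, b 1]`. -/
def comparison (a b : Fin 2 → ℝ) (p : Plane) : ℝ :=
  ∑ α, (p α - a α) * (b α - p α) / 2

/-- The discrete Laplacian is exact on the comparison function: `-Λφ = 2` at interior nodes. -/
lemma sum_transmissibility_comparison (hΩ : Convex ℝ Ω) (hΩo : IsOpen Ω)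
    (hbd : Bornology.IsBounded Ω) (hx : Function.Injective x) (hcl : ∀ i, x i ∈ closure Ω)
    {i : Fin M} (hV : voronoi x i ⊆ Ω) (a b : Fin 2 → ℝ) :
    ∑ j, transmissibility Ω x (fun _ => 1) i j * (comparison a b (x j) - comparison a b (x i)) =
      -2 * area Ω x i := by
  -- the gradient of the comparison function at `x i`
  let g : Plane := WithLp.toLp 2 fun α => (a α + b α) / 2 - x i α
  have h1 : ∀ j, transmissibility Ω x (fun _ => 1) i j *
      (comparison a b (x j) - comparison a b (x i)) =
      ⟪g, (faceLength Ω x i j / dist (x i) (x j)) • (x j - x i)⟫ -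
        2 * (faceLength Ω x i j * dist (x i) (x j) / 4) := by
    intro j
    have hT : comparison a b (x j) - comparison a b (x i) =
        ⟪g, x j - x i⟫ - dist (x i) (x j) ^ 2 / 2 := by
      simp only [comparison, g, EuclideanSpace.dist_sq_eq, Fin.sum_univ_two, Real.dist_eq, sq_abs,
        PiLp.inner_apply, PiLp.sub_apply, RCLike.inner_apply, conj_trivial]
      ring
    rw [hT, inner_smul_right, transmissibility]
    rcases eq_or_ne (dist (x i) (x j)) 0 with h | h
    · simp [h]
    · field_simp
      ring
  rw [Finset.sum_congr rfl fun j _ => h1 j, Finset.sum_sub_distrib, ← inner_sum,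
    sum_faceLength_normal hΩ hΩo hbd hx hcl hV, inner_zero_right, ← Finset.mul_sum,
    ← area_eq hΩ hΩo hbd hx hcl hV]
  ring

lemma comparison_le (a b : Fin 2 → ℝ) (p : Plane) :
    comparison a b p ≤ 2 * ((b 0 - a 0) ^ 2 / 16 + (b 1 - a 1) ^ 2 / 16) := by
  rw [comparison, Fin.sum_univ_two]
  nlinarith [sq_nonneg (p 0 - a 0 - (b 0 - p 0)), sq_nonneg (p 1 - a 1 - (b 1 - p 1))]

lemma comparison_nonneg {a b : Fin 2 → ℝ} (hab : ∀ p ∈ Ω, ∀ α, a α ≤ p α ∧ p α ≤ b α) {p : Plane}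
    (hp : p ∈ closure Ω) : 0 ≤ comparison a b p := by
  have hcl : IsClosed {p : Plane | 0 ≤ comparison a b p} :=
    isClosed_le continuous_const (by unfold comparison; fun_prop)
  refine closure_minimal (fun q hq => ?_) hcl hp
  exact Finset.sum_nonneg fun α _ => div_nonneg
    (mul_nonneg (sub_nonneg.2 (hab q hq α).1) (sub_nonneg.2 (hab q hq α).2)) zero_le_two

lemma comparison_pos (hΩo : IsOpen Ω) {a b : Fin 2 → ℝ}
    (hab : ∀ p ∈ Ω, ∀ α, a α ≤ p α ∧ p α ≤ b α) {p : Plane} (hp : p ∈ Ω) :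
    0 < comparison a b p := by
  obtain ⟨ε, hε, hball⟩ := Metric.isOpen_iff.1 hΩo p hp
  have hmem : ∀ (α : Fin 2) (t : ℝ), |t| < ε → p + EuclideanSpace.single α t ∈ Ω := by
    intro α t ht
    refine hball ?_
    rwa [Metric.mem_ball, dist_self_add_left, PiLp.norm_single, Real.norm_eq_abs]
  refine Finset.sum_pos (fun α _ => ?_) Finset.univ_nonempty
  have h1 := (hab _ (hmem α (ε / 2) (by rw [abs_of_pos] <;> linarith)) α).2
  have h2 := (hab _ (hmem α (-(ε / 2)) (by rw [abs_neg, abs_of_pos] <;> linarith)) α).1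
  simp only [PiLp.add_apply, PiLp.single_apply, if_true] at h1 h2
  exact div_pos (mul_pos (by linarith) (by linarith)) two_pos

/-- The discrete Friedrichs inequality, with the constant `M₀ = max φ / 2`, where `-Λφ = 2`. -/
theorem ip_self_le_mul_ip_laplace (hΩ : Convex ℝ Ω) (hΩo : IsOpen Ω) (hbd : Bornology.IsBounded Ω)
    (hx : Function.Injective x) (hcl : ∀ i, x i ∈ closure Ω)
    (hV : ∀ i, x i ∈ Ω → voronoi x i ⊆ Ω) {a b : Fin 2 → ℝ}
    (hab : ∀ p ∈ Ω, ∀ α, a α ≤ p α ∧ p α ≤ b α) (y : gridSpace Ω x) :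
    ip Ω x y y ≤ ((b 0 - a 0) ^ 2 / 16 + (b 1 - a 1) ^ 2 / 16) * ip Ω x (laplace Ω x y) y := by
  set M₀ : ℝ := (b 0 - a 0) ^ 2 / 16 + (b 1 - a 1) ^ 2 / 16 with hM₀
  have hM₀n : 0 ≤ M₀ := by positivity
  let φ : Fin M → ℝ := fun i => comparison a b (x i)
  have hφ : ∀ i, 0 ≤ φ i := fun i => comparison_nonneg hab (hcl i)
  have hy : ∀ i, φ i = 0 → y.1 i = 0 := fun i h =>
    eq_zero_of_notMem hΩo hcl y fun hi => (comparison_pos hΩo hab hi).ne' h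
  have hB := barta (transmissibility_comm (Ω := Ω) (x := x) fun _ => 1)
    transmissibility_one_nonneg hφ hy
  have hsum : ip Ω x y y ≤
      M₀ * -∑ i, (∑ j, transmissibility Ω x (fun _ => 1) i j * (φ j - φ i)) *
        (y.1 i ^ 2 / φ i) := by
    rw [ip, ← Finset.sum_neg_distrib, Finset.mul_sum]
    refine (Finset.sum_le_sum (g := fun i => M₀ * -((∑ j, transmissibility Ω x (fun _ => 1) i j *
      (φ j - φ i)) * (y.1 i ^ 2 / φ i))) fun i hi => ?_).trans_eq
      (Finset.sum_subset (Finset.subset_univ _) fun i _ hi => ?_)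
    · have hi : x i ∈ Ω := by simpa [interiorNodes] using hi
      have hpos : 0 < φ i := comparison_pos hΩo hab hi
      have hle : φ i ≤ 2 * M₀ := comparison_le a b (x i)
      have hA := area_pos hbd hΩo hx hi
      rw [sum_transmissibility_comparison hΩ hΩo hbd hx hcl (hV i hi)]
      have : M₀ * -(-2 * area Ω x i * (y.1 i ^ 2 / φ i)) =
          area Ω x i * y.1 i * y.1 i * (2 * M₀ / φ i) := by ring
      rw [this]
      refine le_mul_of_one_le_right ?_ ((one_le_div hpos).2 hle)
      rw [mul_assoc]
      exact mul_nonneg hA.le (mul_self_nonneg _)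
    · have : x i ∉ Ω := by simpa [interiorNodes] using hi
      rw [eq_zero_of_notMem hΩo hcl y this]
      simp
  refine hsum.trans (mul_le_mul_of_nonneg_left ?_ hM₀n)
  rw [laplace, ip_diffusion hΩo hbd hx hcl]
  linarith

lemma ip_laplace_self (hΩo : IsOpen Ω) (hbd : Bornology.IsBounded Ω)
    (hx : Function.Injective x) (hcl : ∀ i, x i ∈ closure Ω) (y : gridSpace Ω x) :
    ip Ω x (laplace Ω x y) y = 1 / 2 * ∑ i, ∑ j ∈ neighbours Ω x i,
      faceLength Ω x i j * dist (x i) (x j) * ((y.1 j - y.1 i) / dist (x i) (x j)) ^ 2 := by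
  rw [laplace, ip_diffusion hΩo hbd hx hcl]
  congr 1
  refine Finset.sum_congr rfl fun i _ => (sum_neighbours i _ _ ?_ ?_ ?_).symm
  · intro j hj
    simp [hj]
  · simp
  · intro j
    rw [transmissibility]
    rcases eq_or_ne (dist (x i) (x j)) 0 with h | h
    · simp [h]
    · field_simp

lemma IsConvexPolygon.convex (h : IsConvexPolygon Ω) : Convex ℝ Ω := by
  obtain ⟨s, rfl, -⟩ := h
  exact (convex_convexHull ℝ _).interior

lemma IsConvexPolygon.isOpen (h : IsConvexPolygon Ω) : IsOpen Ω := by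
  obtain ⟨s, rfl, -⟩ := h
  exact isOpen_interior

lemma IsConvexPolygon.isBounded (h : IsConvexPolygon Ω) : Bornology.IsBounded Ω := by
  obtain ⟨s, rfl, -⟩ := h
  exact (isBounded_convexHull.2 s.finite_toSet.isBounded).subset interior_subset

end VoronoiFV

end

theorem lemma4 {M : ℕ} (Ω : Set VoronoiFV.Plane) (x : Fin M → VoronoiFV.Plane)
    (hΩ : VoronoiFV.IsConvexPolygon Ω) (hx : VoronoiFV.IsGrid Ω x)
    -- only the Voronoi polygons of boundary nodes are truncated by the boundary of the domain
    (hV : ∀ i, x i ∈ Ω → VoronoiFV.voronoi x i ⊆ Ω)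
    -- the rectangle with sides parallel to the coordinate axes that contains the polygon
    (a b : Fin 2 → ℝ) (hab : ∀ p ∈ Ω, ∀ α, a α ≤ p α ∧ p α ≤ b α)
    (M₀ : ℝ) (hM₀ : M₀ = (b 0 - a 0) ^ 2 / 16 + (b 1 - a 1) ^ 2 / 16) :
    (∀ y : VoronoiFV.gridSpace Ω x,
      VoronoiFV.gridNorm Ω x y ^ 2 ≤ M₀ * VoronoiFV.ip Ω x (VoronoiFV.laplace Ω x y) y ∧
      VoronoiFV.gridNorm Ω x y ^ 2 ≤ M₀ / 2 *
        ∑ i, ∑ j ∈ VoronoiFV.neighbours Ω x i,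
          VoronoiFV.faceLength Ω x i j * dist (x i) (x j) *
            ((y.1 j - y.1 i) / dist (x i) (x j)) ^ 2) ∧
    (∀ (k : VoronoiFV.Plane → ℝ) (κ : ℝ), 0 < κ → (∀ p ∈ Ω, κ ≤ k p) →
      (∀ y w : VoronoiFV.gridSpace Ω x,
        VoronoiFV.ip Ω x (VoronoiFV.diffusion Ω x k y) w =
          VoronoiFV.ip Ω x y (VoronoiFV.diffusion Ω x k w)) ∧
      (∀ y : VoronoiFV.gridSpace Ω x,
        κ / M₀ * VoronoiFV.ip Ω x y y ≤ VoronoiFV.ip Ω x (VoronoiFV.diffusion Ω x k y) y)) := by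
  have hc := hΩ.convex
  have ho := hΩ.isOpen
  have hbd := hΩ.isBounded
  have hF := VoronoiFV.ip_self_le_mul_ip_laplace hc ho hbd hx.injective hx.mem_closure hV hab
  rw [← hM₀] at hF
  have hnorm : ∀ y : VoronoiFV.gridSpace Ω x,
      VoronoiFV.gridNorm Ω x y ^ 2 = VoronoiFV.ip Ω x y y := by
    intro y
    refine Real.sq_sqrt (Finset.sum_nonneg fun i _ => ?_)
    rw [mul_assoc]
    exact mul_nonneg ENNReal.toReal_nonneg (mul_self_nonneg _)
  have hM₀pos : 0 < M₀ := by
    obtain ⟨-, -, p, hp⟩ := hΩ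
    have h1 := VoronoiFV.comparison_pos ho hab hp
    have h2 := VoronoiFV.comparison_le a b p
    rw [← hM₀] at h2
    linarith
  refine ⟨fun y => ⟨?_, ?_⟩, fun k κ hκ hk => ⟨fun y w => ?_, fun y => ?_⟩⟩
  · rw [hnorm]
    exact hF y
  · rw [hnorm]
    refine (hF y).trans_eq ?_
    rw [VoronoiFV.ip_laplace_self ho hbd hx.injective hx.mem_closure]
    ring
  · have hcomm : VoronoiFV.ip Ω x y (VoronoiFV.diffusion Ω x k w) =
        VoronoiFV.ip Ω x (VoronoiFV.diffusion Ω x k w) y :=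
      Finset.sum_congr rfl fun i _ => mul_right_comm _ _ _
    rw [hcomm, VoronoiFV.ip_diffusion ho hbd hx.injective hx.mem_closure,
      VoronoiFV.ip_diffusion ho hbd hx.injective hx.mem_closure]
    congr 1
    exact Finset.sum_congr rfl fun i _ => Finset.sum_congr rfl fun j _ => mul_right_comm _ _ _
  · refine le_trans ?_
      (VoronoiFV.mul_ip_laplace_le hc ho hbd hx.injective hx.mem_closure hk y)
    rw [div_mul_eq_mul_div, div_le_iff₀ hM₀pos, mul_assoc, mul_comm _ M₀]
    exact mul_le_mul_of_nonneg_left (hF y) hκ.le
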